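/- Let $E$ be a Dedekind complete (real) Riesz space with weak order unit $e$, and let $T$ be a conditional expectation operator on $E$, that is, a strictly positive order continuous linear projection with $Te=e$ and Dedekind complete range. Let $S$ be an order continuous Riesz homomorphism on $E$ with $Se=e$ and $TSf=Tf$ for all $f\in E$; the tuple $(E,T,S,e)$ is then called a conditional expectation preserving system. Let $E^u$ be the universal completion of $E$, that is, the universally complete (Dedekind complete and laterally complete) Riesz space, unique up to isomorphism, that contains $E$ as an order dense Riesz subspace. Put $$D=\{x\in E^u_+ : \text{there is a net } (x_\alpha)\subset E_+ \text{ with } 0\le x_\alpha\uparrow x \text{ and } (Tx_\alpha) \text{ order bounded in } E^u\},\qquad L^1(T)=D-D .$$ Then $L^1(T)$ is a Riesz subspace of $E^u$ that contains $E$, and $T$ extends to $L^1(T)$ by $Tx=\sup_\alpha Tx_\alpha$ for $x\in D$ and $x_\alpha$ as above, and $Tf=Tf^+-Tf^-$ for $f\in L^1(T)$. **Theorem.** Let $(E,T,S,e)$ be a conditional expectation preserving system. Then $S$ has a unique extension to an order continuous Riesz homomorphism $S: L^1(T)\to L^1(T)$, and this extension satisfies $TSf=Tf$ for all $f\in L^1(T)$.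 -/

import Mathlib

/-- Order continuity of a *positive* linear operator between Riesz spaces: `x_α ↓ 0` implies
`f x_α ↓ 0`. A decreasing net is given by its range, a nonempty downward directed set. -/
def IsOrderContinuous {E F : Type*} [AddCommGroup E] [Module ℝ E] [Lattice E]
    [AddCommGroup F] [Module ℝ F] [Lattice F] (f : E →ₗ[ℝ] F) : Prop :=
  ∀ A : Set E, A.Nonempty → DirectedOn (· ≥ ·) A → IsGLB A 0 → IsGLB (f '' A) 0

/-- A Riesz (lattice) homomorphism: a linear map with `f (x ∨ y) = f x ∨ f y`. -/
def IsRieszHom {E F : Type*} [AddCommGroup E] [Module ℝ E] [Lattice E]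
    [AddCommGroup F] [Module ℝ F] [Lattice F] (f : E →ₗ[ℝ] F) : Prop :=
  ∀ x y : E, f (x ⊔ y) = f x ⊔ f y

/-- A conditional Riesz triple `(E, e, T)`: `E` is a Dedekind complete Riesz space, `e` is a weak
order unit of `E`, and `T` is a conditional expectation operator on `E`, that is, a strictly
positive order continuous linear projection with `T e = e` and Dedekind complete range. -/
structure ConditionalRieszTriple (E : Type*) [AddCommGroup E] [ConditionallyCompleteLattice E]
    [IsOrderedAddMonoid E] [Module ℝ E] [IsOrderedModule ℝ E] where
  e : E
  T : E →ₗ[ℝ] E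
  e_nonneg : 0 ≤ e
  e_unit : ∀ x : E, 0 ≤ x → x ⊓ e = 0 → x = 0
  T_nonneg : ∀ x : E, 0 ≤ x → 0 ≤ T x
  T_strict : ∀ x : E, 0 ≤ x → T x = 0 → x = 0
  T_orderContinuous : IsOrderContinuous T
  T_proj : ∀ x : E, T (T x) = T x
  T_e : T e = e
  T_range : ∀ A : Set (LinearMap.range T), A.Nonempty → BddAbove A → ∃ x, IsLUB A x

/-- A conditional expectation preserving system `(E, T, S, e)`: a conditional Riesz triple with an
order continuous Riesz homomorphism `S` on `E` such that `S e = e` and `T S = T`. -/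
structure CondExpPreservingSystem (E : Type*) [AddCommGroup E] [ConditionallyCompleteLattice E]
    [IsOrderedAddMonoid E] [Module ℝ E] [IsOrderedModule ℝ E]
    extends ConditionalRieszTriple E where
  S : E →ₗ[ℝ] E
  S_rieszHom : IsRieszHom S
  S_orderContinuous : IsOrderContinuous S
  S_e : S e = e
  T_S : ∀ f : E, T (S f) = T f

/-- `U` is a universal completion of `E`: a universally complete (Dedekind complete and laterally
complete) Riesz space in which `E` is embedded, through `ι`, as an order dense Riesz subspace.
It is unique up to a Riesz isomorphism that fixes `E`. -/
structure UniversalCompletion (E U : Type*) [AddCommGroup E] [Lattice E] [Module ℝ E]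
    [AddCommGroup U] [ConditionallyCompleteLattice U] [IsOrderedAddMonoid U]
    [Module ℝ U] [IsOrderedModule ℝ U] where
  ι : E →ₗ[ℝ] U
  ι_injective : Function.Injective ι
  ι_rieszHom : IsRieszHom ι
  /-- `E` is order dense in `U`. -/
  orderDense : ∀ u : U, 0 < u → ∃ x : E, 0 < x ∧ ι x ≤ u
  /-- Every nonempty set of pairwise disjoint positive elements of `U` has a supremum. -/
  laterallyComplete : ∀ A : Set U, A.Nonempty → (∀ u ∈ A, 0 ≤ u) →
    A.Pairwise (fun u v => u ⊓ v = 0) → ∃ w, IsLUB A w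

namespace CondExp

section Aux

variable {E F : Type*} [AddCommGroup E] [Lattice E] [IsOrderedAddMonoid E] [Module ℝ E]
  [AddCommGroup F] [Lattice F] [IsOrderedAddMonoid F] [Module ℝ F]

lemma isLUB_inf {A : Set E} {x : E} (h : IsLUB A x) (z : E) :
    IsLUB ((fun a => z ⊓ a) '' A) (z ⊓ x) := by
  constructor
  · rintro _ ⟨a, ha, rfl⟩
    exact inf_le_inf_left z (h.1 ha)
  · intro v hv
    have key : x ≤ v + z ⊔ x - z := by
      apply h.2
      intro a ha
      have h1 : z ⊓ a ≤ v := hv ⟨a, ha, rfl⟩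
      have h2 : z ⊔ a ≤ z ⊔ x := sup_le_sup_left (h.1 ha) z
      have h3 : z ⊓ a + z ⊔ a = z + a := inf_add_sup z a
      have h4 : z + a ≤ v + z ⊔ x := h3 ▸ add_le_add h1 h2
      rw [le_sub_iff_add_le, add_comm]
      exact h4
    have h3 : z ⊓ x + z ⊔ x = z + x := inf_add_sup z x
    rw [le_sub_iff_add_le, add_comm, ← h3] at key
    exact le_of_add_le_add_right key

lemma isLUB_add {A B : Set E} {x y : E} (hA : IsLUB A x) (hB : IsLUB B y) :
    IsLUB (Set.image2 (· + ·) A B) (x + y) := by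
  constructor
  · rintro _ ⟨a, ha, b, hb, rfl⟩
    exact add_le_add (hA.1 ha) (hB.1 hb)
  · intro v hv
    have h1 : x ≤ v - y := by
      apply hA.2
      intro a ha
      have : y ≤ v - a := by
        apply hB.2
        intro b hb
        rw [le_sub_iff_add_le, add_comm]
        exact hv ⟨a, ha, b, hb, rfl⟩
      rw [le_sub_iff_add_le] at this ⊢
      rwa [add_comm]
    exact le_sub_iff_add_le.1 h1

lemma isLUB_image {f : E →ₗ[ℝ] F} (hf : IsOrderContinuous f) {A : Set E} {x : E}
    (hne : A.Nonempty) (hd : DirectedOn (· ≤ ·) A) (h : IsLUB A x) :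
    IsLUB (f '' A) (f x) := by
  have hg : IsGLB ((fun a => x - a) '' A) 0 := by
    constructor
    · rintro _ ⟨a, ha, rfl⟩
      exact sub_nonneg.2 (h.1 ha)
    · intro v hv
      have : x ≤ x - v := by
        apply h.2
        intro a ha
        have : v ≤ x - a := hv ⟨a, ha, rfl⟩
        rw [le_sub_comm]
        exact this
      simpa using this
  have hdd : DirectedOn (· ≥ ·) ((fun a => x - a) '' A) := by
    rintro _ ⟨a, ha, rfl⟩ _ ⟨b, hb, rfl⟩
    obtain ⟨c, hc, hac, hbc⟩ := hd a ha b hb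
    exact ⟨x - c, ⟨c, hc, rfl⟩, sub_le_sub_left hac x, sub_le_sub_left hbc x⟩
  have := hf _ (hne.image _) hdd hg
  constructor
  · rintro _ ⟨a, ha, rfl⟩
    have h0 : 0 ≤ f (x - a) := this.1 ⟨x - a, ⟨a, ha, rfl⟩, rfl⟩
    rw [map_sub] at h0
    exact sub_nonneg.1 h0
  · intro v hv
    have : f x - v ≤ 0 := by
      apply this.2
      rintro _ ⟨_, ⟨a, ha, rfl⟩, rfl⟩
      have hav : f a ≤ v := hv ⟨a, ha, rfl⟩
      simp only [map_sub]
      exact sub_le_sub_left hav _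
    exact sub_nonpos.1 this

end Aux

variable {E U : Type*} [AddCommGroup E] [ConditionallyCompleteLattice E]
  [IsOrderedAddMonoid E] [Module ℝ E] [IsOrderedModule ℝ E]
  [AddCommGroup U] [ConditionallyCompleteLattice U] [IsOrderedAddMonoid U]
  [Module ℝ U] [IsOrderedModule ℝ U]
  (C : ConditionalRieszTriple E) (K : UniversalCompletion E U)

/-- The set `D` of those `x` in the positive cone of the universal completion for which there is a
net `0 ≤ x_α ↑ x` in `E` such that `(T x_α)` is order bounded in the universal completion. An
increasing net is given by its range, a nonempty upward directed set. -/
def L1Cone : Set U :=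
  {x | ∃ A : Set E, A.Nonempty ∧ DirectedOn (· ≤ ·) A ∧ (∀ a ∈ A, 0 ≤ a) ∧
    IsLUB (K.ι '' A) x ∧ BddAbove ((fun a => K.ι (C.T a)) '' A)}

/-- The elements of `E` that lie between `0` and `x`. -/
def minorants (x : U) : Set E := {z | 0 ≤ z ∧ K.ι z ≤ x}

variable {C K}

lemma ι_le_iff {x y : E} : K.ι x ≤ K.ι y ↔ x ≤ y := by
  rw [← sup_eq_right, ← K.ι_rieszHom, K.ι_injective.eq_iff, sup_eq_right]

lemma ι_nonneg {x : E} (h : 0 ≤ x) : 0 ≤ K.ι x := by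
  have := (ι_le_iff (K := K)).2 h
  rwa [map_zero] at this

lemma T_mono {x y : E} (h : x ≤ y) : C.T x ≤ C.T y := by
  have := C.T_nonneg (y - x) (sub_nonneg.2 h)
  rw [map_sub] at this
  exact sub_nonneg.1 this

/-- The embedding into the universal completion preserves suprema. -/
lemma isLUB_ι {A : Set E} {x : E} (h : IsLUB A x) : IsLUB (K.ι '' A) (K.ι x) := by
  constructor
  · rintro _ ⟨a, ha, rfl⟩
    exact ι_le_iff.2 (h.1 ha)
  · intro v hv
    by_contra hlt
    have hne : 0 < K.ι x - v ⊓ K.ι x := by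
      rw [sub_pos]
      exact lt_of_le_of_ne inf_le_right (fun hh => hlt (inf_eq_right.1 hh))
    obtain ⟨y, hy, hyle⟩ := K.orderDense _ hne
    have : x ≤ x - y := by
      apply h.2
      intro a ha
      have h1 : K.ι a ≤ v ⊓ K.ι x := le_inf (hv ⟨a, ha, rfl⟩) (ι_le_iff.2 (h.1 ha))
      have h2 : K.ι a ≤ K.ι x - K.ι y := h1.trans (le_sub_comm.1 hyle)
      rw [← map_sub] at h2
      exact ι_le_iff.1 h2
    have h0 : y ≤ 0 := by simpa using this
    exact absurd hy (not_lt_of_ge h0)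

lemma zero_mem_minorants {x : U} (hx : 0 ≤ x) : (0 : E) ∈ minorants K x :=
  ⟨le_rfl, by rwa [map_zero]⟩

lemma directed_minorants (x : U) : DirectedOn (· ≤ ·) (minorants K x) := by
  rintro a ⟨ha0, hax⟩ b ⟨hb0, hbx⟩
  refine ⟨a ⊔ b, ⟨ha0.trans le_sup_left, ?_⟩, le_sup_left, le_sup_right⟩
  rw [K.ι_rieszHom]
  exact sup_le hax hbx

lemma isLUB_minorants {x : U} (hx : 0 ≤ x) : IsLUB (K.ι '' minorants K x) x := by
  have hbd : BddAbove (K.ι '' minorants K x) := ⟨x, by rintro _ ⟨z, hz, rfl⟩; exact hz.2⟩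
  have hl := isLUB_csSup (Set.Nonempty.image K.ι ⟨0, zero_mem_minorants hx⟩) hbd
  set s := sSup (K.ι '' minorants K x)
  have hsx : s ≤ x := hl.2 (by rintro _ ⟨z, hz, rfl⟩; exact hz.2)
  rcases hsx.eq_or_lt with h | h
  · rwa [h] at hl
  exfalso
  obtain ⟨y, hy, hyle⟩ := K.orderDense _ (sub_pos.2 h)
  have hss : s ≤ s - K.ι y := by
    apply hl.2
    rintro _ ⟨z, hz, rfl⟩
    rw [le_sub_iff_add_le, ← map_add]
    have hzs : K.ι z ≤ s := hl.1 ⟨z, hz, rfl⟩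
    refine hl.1 ⟨z + y, ⟨add_nonneg hz.1 hy.le, ?_⟩, rfl⟩
    rw [map_add]
    calc K.ι z + K.ι y ≤ s + (x - s) := add_le_add hzs hyle
      _ = x := by abel
  have h0 : K.ι y ≤ K.ι 0 := by
    rw [map_zero]
    simpa using hss
  exact absurd hy (not_lt_of_ge (ι_le_iff.1 h0))

lemma ι_T_le {A : Set E} {x w : U} (hne : A.Nonempty) (hd : DirectedOn (· ≤ ·) A)
    (hx : IsLUB (K.ι '' A) x) (hw : w ∈ upperBounds ((fun a => K.ι (C.T a)) '' A))
    {z : E} (hz : K.ι z ≤ x) : K.ι (C.T z) ≤ w := by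
  have h1 := isLUB_inf hx (K.ι z)
  rw [inf_eq_left.2 hz] at h1
  have h2 : IsLUB ((fun a => z ⊓ a) '' A) z := by
    constructor
    · rintro _ ⟨a, -, rfl⟩
      exact inf_le_left
    · intro v hv
      rw [← ι_le_iff (K := K)]
      apply h1.2
      rintro _ ⟨_, ⟨a, ha, rfl⟩, rfl⟩
      have h3 : z ⊓ a ≤ v := hv ⟨a, ha, rfl⟩
      have h4 : K.ι (z ⊓ a) = K.ι z ⊓ K.ι a := by
        have e1 : z ⊓ a = z + a - z ⊔ a := eq_sub_of_add_eq (inf_add_sup z a)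
        have e2 : K.ι z ⊓ K.ι a = K.ι z + K.ι a - K.ι z ⊔ K.ι a :=
          eq_sub_of_add_eq (inf_add_sup _ _)
        rw [e1, e2, map_sub, map_add, K.ι_rieszHom]
      show K.ι z ⊓ K.ι a ≤ K.ι v
      rw [← h4]
      exact ι_le_iff.2 h3
  have hdd : DirectedOn (· ≤ ·) ((fun a => z ⊓ a) '' A) := by
    rintro _ ⟨a, ha, rfl⟩ _ ⟨b, hb, rfl⟩
    obtain ⟨c, hc, hac, hbc⟩ := hd a ha b hb
    exact ⟨z ⊓ c, ⟨c, hc, rfl⟩, inf_le_inf_left z hac, inf_le_inf_left z hbc⟩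
  have h5 := isLUB_ι (K := K) (isLUB_image C.T_orderContinuous (hne.image _) hdd h2)
  apply h5.2
  rintro _ ⟨_, ⟨_, ⟨a, ha, rfl⟩, rfl⟩, rfl⟩
  exact (ι_le_iff.2 (T_mono inf_le_right)).trans (hw ⟨a, ha, rfl⟩)

lemma L1Cone_nonneg {x : U} (hx : x ∈ L1Cone C K) : 0 ≤ x := by
  obtain ⟨A, ⟨a, ha⟩, -, h0, hl, -⟩ := hx
  exact (ι_nonneg (h0 a ha)).trans (hl.1 ⟨a, ha, rfl⟩)

lemma bddAbove_minorants {x : U} (hx : x ∈ L1Cone C K) :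
    BddAbove ((fun z => K.ι (C.T z)) '' minorants K x) := by
  obtain ⟨A, hne, hd, -, hl, w, hw⟩ := hx
  refine ⟨w, ?_⟩
  rintro _ ⟨z, hz, rfl⟩
  exact ι_T_le hne hd hl hw hz.2

lemma L1Cone_solid {x y : U} (hx : x ∈ L1Cone C K) (hy : 0 ≤ y) (hyx : y ≤ x) :
    y ∈ L1Cone C K := by
  refine ⟨minorants K y, ⟨0, zero_mem_minorants hy⟩, directed_minorants y, fun a ha => ha.1,
    isLUB_minorants hy, (bddAbove_minorants hx).mono ?_⟩
  exact Set.image_mono fun z hz => ⟨hz.1, hz.2.trans hyx⟩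

lemma L1Cone_ι {z : E} (hz : 0 ≤ z) : K.ι z ∈ L1Cone C K := by
  refine ⟨{z}, Set.singleton_nonempty z, ?_, by simpa using hz, by simp, by simp⟩
  rintro a rfl b rfl
  exact ⟨_, rfl, le_rfl, le_rfl⟩

lemma L1Cone_add {x y : U} (hx : x ∈ L1Cone C K) (hy : y ∈ L1Cone C K) :
    x + y ∈ L1Cone C K := by
  obtain ⟨A, hne, hd, h0, hl, w, hw⟩ := hx
  obtain ⟨B, hne', hd', h0', hl', w', hw'⟩ := hy
  refine ⟨Set.image2 (· + ·) A B, hne.image2 hne', ?_, ?_, ?_, w + w', ?_⟩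
  · rintro _ ⟨a, ha, b, hb, rfl⟩ _ ⟨a', ha', b', hb', rfl⟩
    obtain ⟨c, hc, h1, h2⟩ := hd a ha a' ha'
    obtain ⟨d, hdB, h3, h4⟩ := hd' b hb b' hb'
    exact ⟨c + d, ⟨c, hc, d, hdB, rfl⟩, add_le_add h1 h3, add_le_add h2 h4⟩
  · rintro _ ⟨a, ha, b, hb, rfl⟩
    exact add_nonneg (h0 a ha) (h0' b hb)
  · have := isLUB_add hl hl'
    rwa [← Set.image_image2_distrib (g := K.ι) (f := (· + ·)) (fun a b => map_add K.ι a b)]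
      at this
  · rintro _ ⟨_, ⟨a, ha, b, hb, rfl⟩, rfl⟩
    simp only [map_add]
    exact add_le_add (hw ⟨a, ha, rfl⟩) (hw' ⟨b, hb, rfl⟩)

lemma L1Cone_smul {x : U} (hx : x ∈ L1Cone C K) {c : ℝ} (hc : 0 ≤ c) :
    c • x ∈ L1Cone C K := by
  obtain ⟨n, hn⟩ := exists_nat_ge c
  have hx0 := L1Cone_nonneg hx
  have hnx : ∀ n : ℕ, (n : ℝ) • x ∈ L1Cone C K := by
    intro n
    induction n with
    | zero => simpa using L1Cone_ι (C := C) (K := K) (le_refl (0 : E))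
    | succ k ih =>
      rw [Nat.cast_succ, add_smul, one_smul]
      exact L1Cone_add ih hx
  exact L1Cone_solid (hnx n) (smul_nonneg hc hx0) (smul_le_smul_of_nonneg_right hn hx0)

variable (C K)

/-- The natural domain `L¹(T) = D - D` of the conditional expectation `T`. -/
def L1 : Submodule ℝ U where
  carrier := {f | ∃ x ∈ L1Cone C K, ∃ y ∈ L1Cone C K, f = x - y}
  zero_mem' := by
    have h0 : (0 : U) ∈ L1Cone C K := by
      simpa using L1Cone_ι (C := C) (K := K) (le_refl (0 : E))
    exact ⟨0, h0, 0, h0, by simp⟩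
  add_mem' := by
    rintro _ _ ⟨x, hx, y, hy, rfl⟩ ⟨x', hx', y', hy', rfl⟩
    exact ⟨x + x', L1Cone_add hx hx', y + y', L1Cone_add hy hy', by abel⟩
  smul_mem' := by
    rintro c _ ⟨x, hx, y, hy, rfl⟩
    rcases le_total 0 c with hc | hc
    · exact ⟨c • x, L1Cone_smul hx hc, c • y, L1Cone_smul hy hc, smul_sub c x y⟩
    · have hc' : 0 ≤ -c := neg_nonneg.2 hc
      refine ⟨(-c) • y, L1Cone_smul hy hc', (-c) • x, L1Cone_smul hx hc', ?_⟩
      rw [smul_sub, neg_smul, neg_smul]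
      abel

variable {C K}

lemma L1Cone_sup_zero {f : U} (hf : f ∈ L1 C K) : f ⊔ 0 ∈ L1Cone C K := by
  obtain ⟨x, hx, y, hy, rfl⟩ := hf
  exact L1Cone_solid hx le_sup_right
    (sup_le (sub_le_self x (L1Cone_nonneg hy)) (L1Cone_nonneg hx))

lemma L1_of_cone {x : U} (hx : x ∈ L1Cone C K) : x ∈ L1 C K :=
  ⟨x, hx, 0, by simpa using L1Cone_ι (C := C) (K := K) (le_refl (0 : E)), by simp⟩

lemma L1_sup {f g : U} (hf : f ∈ L1 C K) (hg : g ∈ L1 C K) : f ⊔ g ∈ L1 C K := by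
  have h : f ⊔ g = (f - g) ⊔ 0 + g := by rw [sup_add]; simp
  rw [h]
  exact (L1 C K).add_mem (L1_of_cone (L1Cone_sup_zero ((L1 C K).sub_mem hf hg))) hg

lemma L1_inf {f g : U} (hf : f ∈ L1 C K) (hg : g ∈ L1 C K) : f ⊓ g ∈ L1 C K := by
  have h : f ⊓ g = f + g - f ⊔ g := eq_sub_of_add_eq (inf_add_sup f g)
  rw [h]
  exact (L1 C K).sub_mem ((L1 C K).add_mem hf hg) (L1_sup hf hg)

/-- `L¹(T)` is a Riesz subspace of the universal completion, with the inherited order. -/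
instance : Lattice (L1 C K) :=
  Subtype.lattice (fun _ _ hf hg => L1_sup hf hg) (fun _ _ hf hg => L1_inf hf hg)

lemma L1_ι (z : E) : K.ι z ∈ L1 C K := by
  have h : K.ι z = K.ι (z ⊔ 0) - K.ι (z ⊔ 0 - z) := by rw [map_sub]; abel
  exact ⟨_, L1Cone_ι le_sup_right, _, L1Cone_ι (sub_nonneg.2 le_sup_left), h⟩

variable (C K)

/-- The inclusion of `E` into `L¹(T)`. -/
def toL1 : E →ₗ[ℝ] L1 C K := K.ι.codRestrict (L1 C K) L1_ι

/-- The value `sup {T z : z ∈ E, 0 ≤ z ≤ x}` of the extension of `T` at an element `x` of the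
cone `D`; it is `sup T x_α` for every net `0 ≤ x_α ↑ x` in `E`, see `isLUB_condExpCone`. -/
noncomputable def condExpCone (x : U) : U := sSup ((fun z => K.ι (C.T z)) '' minorants K x)

variable {C K}

lemma isLUB_condExpCone {x : U} (hx : x ∈ L1Cone C K) {A : Set E} (hne : A.Nonempty)
    (hd : DirectedOn (· ≤ ·) A) (h0 : ∀ a ∈ A, 0 ≤ a) (hA : IsLUB (K.ι '' A) x) :
    IsLUB ((fun a => K.ι (C.T a)) '' A) (condExpCone C K x) := by
  have hl : IsLUB ((fun z => K.ι (C.T z)) '' minorants K x) (condExpCone C K x) :=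
    isLUB_csSup ⟨_, ⟨0, zero_mem_minorants (L1Cone_nonneg hx), rfl⟩⟩ (bddAbove_minorants hx)
  constructor
  · rintro _ ⟨a, ha, rfl⟩
    exact hl.1 ⟨a, ⟨h0 a ha, hA.1 ⟨a, ha, rfl⟩⟩, rfl⟩
  · intro w hw
    apply hl.2
    rintro _ ⟨z, hz, rfl⟩
    exact ι_T_le hne hd hA hw hz.2

lemma condExpCone_mem {x : U} (hx : x ∈ L1Cone C K) : condExpCone C K x ∈ L1 C K := by
  have hx0 := L1Cone_nonneg hx
  have hl := isLUB_condExpCone hx ⟨0, zero_mem_minorants hx0⟩ (directed_minorants x)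
    (fun a ha => ha.1) (isLUB_minorants hx0)
  refine L1_of_cone ⟨C.T '' minorants K x, ⟨_, ⟨0, zero_mem_minorants hx0, rfl⟩⟩, ?_, ?_, ?_, ?_⟩
  · rintro _ ⟨a, ha, rfl⟩ _ ⟨b, hb, rfl⟩
    obtain ⟨c, hc, h1, h2⟩ := directed_minorants x a ha b hb
    exact ⟨C.T c, ⟨c, hc, rfl⟩, T_mono h1, T_mono h2⟩
  · rintro _ ⟨a, ha, rfl⟩
    exact C.T_nonneg a ha.1
  · rwa [Set.image_image]
  · rw [Set.image_image]
    simp only [C.T_proj]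
    exact bddAbove_minorants hx

variable (C K)

/-- The extension of the conditional expectation `T` to its natural domain `L¹(T)`:
`T f = T f⁺ - T f⁻`, with `T x = sup T x_α` for `x` in the cone `D` and `0 ≤ x_α ↑ x` in `E`. -/
noncomputable def condExp (f : L1 C K) : L1 C K :=
  ⟨condExpCone C K (f : U)⁺ - condExpCone C K (f : U)⁻,
    (L1 C K).sub_mem (condExpCone_mem (L1Cone_sup_zero f.2))
      (condExpCone_mem (L1Cone_sup_zero ((L1 C K).neg_mem f.2)))⟩

end CondExp

/-!
An order continuous operator `R` on `E` extends uniquely along an order dense embedding of `E` into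
`L`, by `R x = sup {R z : z ∈ E, 0 ≤ z ≤ x}` for `x ≥ 0`, as soon as these sets are bounded above.
A positive `S` with `T S = T` inherits order continuity from `T`, because `T` is strictly positive,
so the crux is the boundedness of `B = {S z : 0 ≤ z ≤ x}` in the universal completion. If `B` were
unbounded, lateral completeness would provide a `q > 0` such that `n q = sup {n q ⊓ b : b ∈ B}` for
every `n`. Since `T B = {T z : 0 ≤ z ≤ x}` is bounded, all multiples of `T p` would then be bounded
for any `p ∈ E` with `0 < p ≤ q`, so that `T p = 0`, contradicting strict positivity.

The conditional expectation on `L¹(T)` is itself the extension of `T`, so `T S = T` on `L¹(T)`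
follows from the uniqueness of order continuous extensions.
-/

section PositiveOperators

variable {E F H : Type*} [AddCommGroup E] [Lattice E] [Module ℝ E]
  [AddCommGroup F] [Lattice F] [Module ℝ F] [AddCommGroup H] [Lattice H] [Module ℝ H]
  {f : E →ₗ[ℝ] F} {g : F →ₗ[ℝ] H}

theorem IsRieszHom.monotone (hf : IsRieszHom f) : Monotone f := fun x y hxy => by
  rw [← sup_eq_right, ← hf, sup_eq_right.2 hxy]

theorem IsRieszHom.le_iff_le (hf : IsRieszHom f) (hinj : Function.Injective f) {x y : E} :
    f x ≤ f y ↔ x ≤ y := by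
  rw [← sup_eq_right, ← hf, hinj.eq_iff, sup_eq_right]

theorem IsRieszHom.comp (hg : IsRieszHom g) (hf : IsRieszHom f) : IsRieszHom (g ∘ₗ f) :=
  fun x y => by simp only [LinearMap.comp_apply, hf x y, hg (f x) (f y)]

theorem IsRieszHom.of_comp (hg : IsRieszHom g) (hinj : Function.Injective g)
    (hgf : IsRieszHom (g ∘ₗ f)) : IsRieszHom f :=
  fun x y => hinj ((hgf x y).trans (hg (f x) (f y)).symm)

theorem IsOrderContinuous.comp (hg : IsOrderContinuous g) (hf : IsOrderContinuous f)
    (hmono : Monotone f) : IsOrderContinuous (g ∘ₗ f) := fun A hne hd hA => by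
  rw [LinearMap.coe_comp, Set.image_comp]
  exact hg _ (hne.image f) (hd.mono_comp fun _ _ h => hmono h) (hf A hne hd hA)

theorem IsOrderContinuous.of_comp (hg : IsRieszHom g) (hinj : Function.Injective g)
    (hgf : IsOrderContinuous (g ∘ₗ f)) : IsOrderContinuous f := fun A hne hd hA => by
  refine IsGLB.of_image (hg.le_iff_le hinj) ?_
  simpa only [LinearMap.coe_comp, Set.image_comp, map_zero] using hgf A hne hd hA

variable [IsOrderedAddMonoid E] [IsOrderedAddMonoid F]

theorem IsRieszHom.map_inf (hf : IsRieszHom f) (x y : E) : f (x ⊓ y) = f x ⊓ f y := by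
  rw [eq_sub_of_add_eq (inf_add_sup x y), eq_sub_of_add_eq (inf_add_sup (f x) (f y)), map_sub,
    map_add, hf]

theorem isRieszHom_of_disjoint (hf : ∀ x y, x ⊓ y = 0 → f x ⊓ f y = 0) : IsRieszHom f := by
  intro x y
  have hdisj : (x - x ⊓ y) ⊓ (y - x ⊓ y) = 0 := by rw [← inf_sub, sub_self]
  have hinf : f x ⊓ f y = f (x ⊓ y) := by
    simpa only [map_sub, ← inf_sub, sub_eq_zero] using hf _ _ hdisj
  rw [eq_sub_of_add_eq' (inf_add_sup x y), eq_sub_of_add_eq' (inf_add_sup (f x) (f y)), hinf,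
    map_sub, map_add]

theorem isOrderContinuous_of_isLUB_image (hf : Monotone f)
    (hsup : ∀ A : Set E, A.Nonempty → DirectedOn (· ≤ ·) A → (∀ a ∈ A, 0 ≤ a) →
      ∀ x, IsLUB A x → IsLUB (f '' A) (f x)) : IsOrderContinuous f := by
  rintro A ⟨a₀, ha₀⟩ hd hA
  have hB : IsLUB ((fun a => a₀ - a) '' {a ∈ A | a ≤ a₀}) a₀ := by
    refine ⟨Set.forall_mem_image.2 fun a ha => sub_le_self _ (hA.1 ha.1), fun v hv => ?_⟩
    refine sub_nonpos.1 (hA.2 fun a ha => ?_)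
    obtain ⟨c, hc, hca, hca₀⟩ := hd a ha a₀ ha₀
    exact (sub_le_comm.1 (hv ⟨c, ⟨hc, hca₀⟩, rfl⟩)).trans hca
  have hBd : DirectedOn (· ≤ ·) ((fun a => a₀ - a) '' {a ∈ A | a ≤ a₀}) := by
    refine DirectedOn.mono_comp (r := (· ≥ ·)) (fun _ _ h => sub_le_sub_left h a₀) ?_
    rintro a ⟨ha, haa₀⟩ b ⟨hb, -⟩
    obtain ⟨c, hc, hca, hcb⟩ := hd a ha b hb
    exact ⟨c, ⟨hc, hca.trans haa₀⟩, hca, hcb⟩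
  have hfB := hsup ((fun a => a₀ - a) '' {a ∈ A | a ≤ a₀}) (.image _ ⟨a₀, ha₀, le_rfl⟩) hBd
    (Set.forall_mem_image.2 fun a ha => sub_nonneg.2 ha.2) a₀ hB
  refine ⟨Set.forall_mem_image.2 fun a ha => ?_, fun w hw => ?_⟩
  · simpa only [map_zero] using hf (hA.1 ha)
  · have hle : f a₀ ≤ f a₀ - w := by
      refine hfB.2 (Set.forall_mem_image.2 (Set.forall_mem_image.2 fun a ha => ?_))
      rw [map_sub]
      exact sub_le_sub_left (hw ⟨a, ha.1, rfl⟩) _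
    simpa only [le_sub_self_iff] using hle

end PositiveOperators

namespace CondExp

section FromPositiveCone

variable {L V : Type*} [AddCommGroup L] [Lattice L] [IsOrderedAddMonoid L] [AddCommGroup V]
  {φ : L → V}

theorem map_posPart_sub_map_negPart (hadd : ∀ x y, 0 ≤ x → 0 ≤ y → φ (x + y) = φ x + φ y)
    {a b : L} (ha : 0 ≤ a) (hb : 0 ≤ b) : φ (a - b)⁺ - φ (a - b)⁻ = φ a - φ b := by
  have h : (a - b)⁺ + b = a + (a - b)⁻ := by
    rw [← sub_eq_sub_iff_add_eq_add, posPart_sub_negPart]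
  rw [sub_eq_sub_iff_add_eq_add, ← hadd _ _ (posPart_nonneg _) hb, h,
    hadd _ _ ha (negPart_nonneg _)]

variable [Module ℝ L] [IsOrderedModule ℝ L] [Module ℝ V]

/-- Kantorovich's extension of an additive, positively homogeneous function on the positive cone
to a linear map on the whole space. The values of `φ` off the positive cone are irrelevant. -/
def linearMapOfCone (φ : L → V) (hadd : ∀ x y, 0 ≤ x → 0 ≤ y → φ (x + y) = φ x + φ y)
    (hsmul : ∀ (c : ℝ) (x : L), 0 ≤ c → 0 ≤ x → φ (c • x) = c • φ x) : L →ₗ[ℝ] V where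
  toFun f := φ f⁺ - φ f⁻
  map_add' f g := by
    have h : f + g = (f⁺ + g⁺) - (f⁻ + g⁻) := by
      rw [add_sub_add_comm, posPart_sub_negPart, posPart_sub_negPart]
    rw [h, map_posPart_sub_map_negPart hadd (add_nonneg (posPart_nonneg f) (posPart_nonneg g))
        (add_nonneg (negPart_nonneg f) (negPart_nonneg g)),
      hadd _ _ (posPart_nonneg f) (posPart_nonneg g),
      hadd _ _ (negPart_nonneg f) (negPart_nonneg g), add_sub_add_comm]
  map_smul' c f := by
    have h : c • f = c • f⁺ - c • f⁻ := by rw [← smul_sub, posPart_sub_negPart]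
    rcases le_total 0 c with hc | hc
    · rw [h, map_posPart_sub_map_negPart hadd (smul_nonneg hc (posPart_nonneg f))
        (smul_nonneg hc (negPart_nonneg f)), hsmul c _ hc (posPart_nonneg f),
        hsmul c _ hc (negPart_nonneg f), ← smul_sub, RingHom.id_apply]
    · have hc' := neg_nonneg.2 hc
      have h' : c • f = (-c) • f⁻ - (-c) • f⁺ := by rw [h, neg_smul, neg_smul]; abel
      rw [h', map_posPart_sub_map_negPart hadd (smul_nonneg hc' (negPart_nonneg f))
        (smul_nonneg hc' (posPart_nonneg f)), hsmul _ _ hc' (posPart_nonneg f),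
        hsmul _ _ hc' (negPart_nonneg f), neg_smul, neg_smul, RingHom.id_apply, smul_sub]
      abel

theorem linearMapOfCone_of_nonneg (hadd : ∀ x y, 0 ≤ x → 0 ≤ y → φ (x + y) = φ x + φ y)
    (hsmul : ∀ (c : ℝ) (x : L), 0 ≤ c → 0 ≤ x → φ (c • x) = c • φ x) {x : L} (hx : 0 ≤ x) :
    linearMapOfCone φ hadd hsmul x = φ x := by
  have h0 : φ 0 = 0 := by simpa only [zero_smul] using hsmul 0 0 le_rfl le_rfl
  change φ x⁺ - φ x⁻ = φ x
  rw [posPart_of_nonneg hx, negPart_of_nonneg hx, h0, sub_zero]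

end FromPositiveCone

theorem inf_le_of_isLUB {G : Type*} [AddCommGroup G] [Lattice G] [IsOrderedAddMonoid G]
    [Module ℝ G] {A B : Set G} {x y c : G} (hA : IsLUB A x) (hB : IsLUB B y)
    (h : ∀ a ∈ A, ∀ b ∈ B, a ⊓ b ≤ c) : x ⊓ y ≤ c := by
  refine (isLUB_inf hB x).2 (Set.forall_mem_image.2 fun b hb => ?_)
  rw [inf_comm]
  refine (isLUB_inf hA b).2 (Set.forall_mem_image.2 fun a ha => ?_)
  rw [inf_comm]
  exact h a ha b hb

theorem directedOn_image2_add {G : Type*} [Add G] [Preorder G] [AddLeftMono G] [AddRightMono G]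
    {A B : Set G} (hA : DirectedOn (· ≤ ·) A) (hB : DirectedOn (· ≤ ·) B) :
    DirectedOn (· ≤ ·) (Set.image2 (· + ·) A B) := by
  rintro _ ⟨a, ha, b, hb, rfl⟩ _ ⟨a', ha', b', hb', rfl⟩
  obtain ⟨c, hc, hac, hac'⟩ := hA a ha a' ha'
  obtain ⟨d, hd, hbd, hbd'⟩ := hB b hb b' hb'
  exact ⟨c + d, ⟨c, hc, d, hd, rfl⟩, add_le_add hac hbd, add_le_add hac' hbd'⟩

section Extension

variable {E L V : Type*} [AddCommGroup E] [Lattice E] [Module ℝ E]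
  [AddCommGroup L] [Lattice L] [Module ℝ L]

/-- The positive elements of `E` whose image under `j : E → L` lies below `x`. -/
def posMinorants (j : E →ₗ[ℝ] L) (x : L) : Set E := {z | 0 ≤ z ∧ j z ≤ x}

/-- `j` embeds `E` into `L` as an order dense Riesz subspace. Order density is expressed by the
property that extension arguments use: every positive `x` is the supremum of the positive elements
of `E` below it. In Archimedean spaces this is equivalent to the usual definition, by which every
`x > 0` has a `z ∈ E` with `0 < j z ≤ x`. -/
structure IsOrderDenseEmbedding (j : E →ₗ[ℝ] L) : Prop where
  rieszHom : IsRieszHom j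
  injective : Function.Injective j
  isLUB_posMinorants : ∀ x, 0 ≤ x → IsLUB (j '' posMinorants j x) x

variable {j : E →ₗ[ℝ] L}

theorem posMinorants_nonempty {x : L} (hx : 0 ≤ x) : (posMinorants j x).Nonempty :=
  ⟨0, le_rfl, by rwa [map_zero]⟩

theorem IsOrderDenseEmbedding.directedOn_posMinorants (hj : IsOrderDenseEmbedding j) (x : L) :
    DirectedOn (· ≤ ·) (posMinorants j x) := fun a ha b hb =>
  ⟨a ⊔ b, ⟨ha.1.trans le_sup_left, (hj.rieszHom a b).trans_le (sup_le ha.2 hb.2)⟩,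
    le_sup_left, le_sup_right⟩

theorem IsOrderDenseEmbedding.linearMap_ext [IsOrderedAddMonoid L] [AddCommGroup V] [Lattice V]
    [IsOrderedAddMonoid V] [Module ℝ V] (hj : IsOrderDenseEmbedding j) {f g : L →ₗ[ℝ] V}
    (hf : IsOrderContinuous f) (hg : IsOrderContinuous g) (hfg : ∀ z, f (j z) = g (j z)) :
    f = g := by
  have hpos : ∀ x, 0 ≤ x → f x = g x := fun x hx => by
    have hne := (posMinorants_nonempty (j := j) hx).image j
    have hd : DirectedOn (· ≤ ·) (j '' posMinorants j x) :=
      (hj.directedOn_posMinorants x).mono_comp fun _ _ h => hj.rieszHom.monotone h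
    have hlub := hj.isLUB_posMinorants x hx
    have hfx := isLUB_image hf hne hd hlub
    rw [Set.image_image] at hfx
    simp only [hfg] at hfx
    rw [← Set.image_image g] at hfx
    exact hfx.unique (isLUB_image hg hne hd hlub)
  ext x
  rw [← posPart_sub_negPart x, map_sub, map_sub, hpos _ (posPart_nonneg x),
    hpos _ (negPart_nonneg x)]

variable [AddCommGroup V] [ConditionallyCompleteLattice V] [Module ℝ V]

/-- The conditions under which the linear map `R` on `E` extends, along the order dense embedding
`j : E → L`, to an order continuous positive linear map on `L`. -/
structure IsOrderExtendable (j : E →ₗ[ℝ] L) (R : E →ₗ[ℝ] V) : Prop where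
  monotone : Monotone R
  orderContinuous : IsOrderContinuous R
  bddAbove_image_posMinorants : ∀ x, 0 ≤ x → BddAbove (R '' posMinorants j x)

/-- The value `sup {R z : z ∈ E, 0 ≤ z ≤ x}` at `x ≥ 0` of the order continuous extension of `R`. -/
noncomputable def extensionOnCone (j : E →ₗ[ℝ] L) (R : E →ₗ[ℝ] V) (x : L) : V :=
  sSup (R '' posMinorants j x)

variable {R : E →ₗ[ℝ] V}

theorem isLUB_image_posMinorants (hR : IsOrderExtendable j R) {x : L} (hx : 0 ≤ x) :
    IsLUB (R '' posMinorants j x) (extensionOnCone j R x) :=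
  isLUB_csSup ((posMinorants_nonempty hx).image R) (hR.bddAbove_image_posMinorants x hx)

variable [IsOrderedAddMonoid E] [IsOrderedAddMonoid L] [IsOrderedAddMonoid V]

/-- A positive `z` with `j z ≤ x` is the supremum of `z ⊓ a`, `a ∈ A`, so order continuity bounds
`R z` by any bound of `R '' A`; hence the supremum does not depend on the approximating net. -/
theorem isLUB_image_extensionOnCone (hj : IsOrderDenseEmbedding j) (hR : IsOrderExtendable j R)
    {A : Set E} (hne : A.Nonempty) (hd : DirectedOn (· ≤ ·) A) (h0 : ∀ a ∈ A, 0 ≤ a) {x : L}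
    (hA : IsLUB (j '' A) x) : IsLUB (R '' A) (extensionOnCone j R x) := by
  obtain ⟨a₀, ha₀⟩ := hne
  have hx : 0 ≤ x := (map_zero j ▸ hj.rieszHom.monotone (h0 a₀ ha₀)).trans (hA.1 ⟨a₀, ha₀, rfl⟩)
  refine ⟨Set.forall_mem_image.2 fun a ha => le_csSup (hR.bddAbove_image_posMinorants x hx)
    ⟨a, ⟨h0 a ha, hA.1 ⟨a, ha, rfl⟩⟩, rfl⟩, fun w hw => ?_⟩
  refine csSup_le ((posMinorants_nonempty hx).image R) (Set.forall_mem_image.2 fun z hz => ?_)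
  have hz_lub : IsLUB ((fun a => z ⊓ a) '' A) z := by
    refine IsLUB.of_image (hj.rieszHom.le_iff_le hj.injective) ?_
    simpa only [Set.image_image, hj.rieszHom.map_inf, inf_eq_left.2 hz.2]
      using isLUB_inf hA (j z)
  have hzd : DirectedOn (· ≤ ·) ((fun a => z ⊓ a) '' A) :=
    hd.mono_comp fun _ _ h => inf_le_inf_left z h
  refine (isLUB_image hR.orderContinuous (.image _ ⟨a₀, ha₀⟩) hzd hz_lub).2
    (Set.forall_mem_image.2 (Set.forall_mem_image.2 fun a ha => ?_))
  exact (hR.monotone inf_le_right).trans (hw ⟨a, ha, rfl⟩)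

theorem extensionOnCone_add (hj : IsOrderDenseEmbedding j) (hR : IsOrderExtendable j R) {x y : L}
    (hx : 0 ≤ x) (hy : 0 ≤ y) :
    extensionOnCone j R (x + y) = extensionOnCone j R x + extensionOnCone j R y := by
  have hlub := isLUB_image_extensionOnCone hj hR
    ((posMinorants_nonempty hx).image2 (posMinorants_nonempty hy))
    (directedOn_image2_add (hj.directedOn_posMinorants x) (hj.directedOn_posMinorants y))
    (Set.forall_mem_image2.2 fun a ha b hb => add_nonneg ha.1 hb.1)
    (x := x + y) (by
      rw [Set.image_image2_distrib (map_add j)]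
      exact isLUB_add (hj.isLUB_posMinorants x hx) (hj.isLUB_posMinorants y hy))
  rw [Set.image_image2_distrib (map_add R)] at hlub
  exact hlub.unique (isLUB_add (isLUB_image_posMinorants hR hx) (isLUB_image_posMinorants hR hy))

variable [IsOrderedModule ℝ L] [IsOrderedModule ℝ E] [IsOrderedModule ℝ V]

theorem extensionOnCone_smul (hj : IsOrderDenseEmbedding j) (hR : IsOrderExtendable j R) {c : ℝ}
    {x : L} (hc : 0 ≤ c) (hx : 0 ≤ x) :
    extensionOnCone j R (c • x) = c • extensionOnCone j R x := by
  rcases hc.eq_or_lt with rfl | hc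
  · have h0 := extensionOnCone_add hj hR (le_refl 0) (le_refl 0)
    rw [add_zero, left_eq_add] at h0
    rw [zero_smul, zero_smul, h0]
  have hlub := isLUB_image_extensionOnCone hj hR (x := c • x)
    ((posMinorants_nonempty hx).image (c • ·))
    ((hj.directedOn_posMinorants x).mono_comp fun _ _ h => smul_le_smul_of_nonneg_left h hc.le)
    (Set.forall_mem_image.2 fun a ha => smul_nonneg hc.le ha.1) (by
      rw [Set.image_image]
      simp only [map_smul]
      rw [← Set.image_image (c • ·) j]
      exact (OrderIso.smulRight hc).isLUB_image'.2 (hj.isLUB_posMinorants x hx))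
  rw [Set.image_image] at hlub
  simp only [map_smul] at hlub
  rw [← Set.image_image (c • ·) R] at hlub
  exact hlub.unique ((OrderIso.smulRight hc).isLUB_image'.2 (isLUB_image_posMinorants hR hx))

/-- The order continuous extension of `R` along the order dense embedding `j : E → L`. -/
noncomputable def extension (hj : IsOrderDenseEmbedding j) (hR : IsOrderExtendable j R) :
    L →ₗ[ℝ] V :=
  linearMapOfCone (extensionOnCone j R) (fun _ _ hx hy => extensionOnCone_add hj hR hx hy)
    (fun _ _ hc hx => extensionOnCone_smul hj hR hc hx)

variable (hj : IsOrderDenseEmbedding j) (hR : IsOrderExtendable j R)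

theorem isLUB_image_extension {A : Set E} (hne : A.Nonempty) (hd : DirectedOn (· ≤ ·) A)
    (h0 : ∀ a ∈ A, 0 ≤ a) {x : L} (hx : 0 ≤ x) (hA : IsLUB (j '' A) x) :
    IsLUB (R '' A) (extension hj hR x) := by
  rw [extension, linearMapOfCone_of_nonneg _ _ hx]
  exact isLUB_image_extensionOnCone hj hR hne hd h0 hA

theorem isLUB_image_posMinorants_extension {x : L} (hx : 0 ≤ x) :
    IsLUB (R '' posMinorants j x) (extension hj hR x) :=
  isLUB_image_extension hj hR (posMinorants_nonempty hx) (hj.directedOn_posMinorants x)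
    (fun _ ha => ha.1) hx (hj.isLUB_posMinorants x hx)

theorem extension_comp_self : extension hj hR ∘ₗ j = R := by
  have hpos : ∀ z, 0 ≤ z → extension hj hR (j z) = R z := fun z hz => by
    have hlub := isLUB_image_extension hj hR (Set.singleton_nonempty z) (directedOn_singleton z)
      (fun _ ha => ha ▸ hz) (map_zero j ▸ hj.rieszHom.monotone hz)
      (by simpa only [Set.image_singleton] using isLUB_singleton)
    rw [Set.image_singleton] at hlub
    exact hlub.unique isLUB_singleton
  ext z
  rw [LinearMap.comp_apply, ← posPart_sub_negPart z, map_sub, map_sub, map_sub,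
    hpos _ (posPart_nonneg z), hpos _ (negPart_nonneg z)]

theorem extension_monotone : Monotone (extension hj hR) :=
  (monotone_iff_map_nonneg _).2 fun x hx => by
    simpa only [map_zero] using (isLUB_image_posMinorants_extension hj hR hx).1
      ⟨0, ⟨le_rfl, by rwa [map_zero]⟩, rfl⟩

theorem extension_isOrderContinuous : IsOrderContinuous (extension hj hR) := by
  refine isOrderContinuous_of_isLUB_image (extension_monotone hj hR) fun A hne hd h0 x hA => ?_
  obtain ⟨a₀, ha₀⟩ := hne
  have hx : 0 ≤ x := (h0 a₀ ha₀).trans (hA.1 ha₀)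
  have hAj : IsLUB (j '' ⋃ f : A, posMinorants j f) x := by
    rw [Set.image_iUnion,
      ← isLUB_iUnion_iff_of_isLUB fun f : A => hj.isLUB_posMinorants f (h0 f f.2)]
    simpa only [Subtype.range_coe] using hA
  have hdir : DirectedOn (· ≤ ·) (⋃ f : A, posMinorants j (f : L)) := by
    refine Set.directedOn_iUnion (fun f g => ?_) fun f => hj.directedOn_posMinorants _
    obtain ⟨h, hh, hfh, hgh⟩ := hd f f.2 g g.2
    exact ⟨⟨h, hh⟩, fun z hz => ⟨hz.1, hz.2.trans hfh⟩, fun z hz => ⟨hz.1, hz.2.trans hgh⟩⟩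
  have hne : (⋃ f : A, posMinorants j (f : L)).Nonempty :=
    Set.nonempty_iUnion.2 ⟨⟨a₀, ha₀⟩, posMinorants_nonempty (h0 a₀ ha₀)⟩
  have hlub := isLUB_image_extension hj hR hne hdir
    (fun z hz => (Set.mem_iUnion.1 hz).elim fun _ h => h.1) hx hAj
  rw [Set.image_iUnion, ← isLUB_iUnion_iff_of_isLUB
    fun f : A => isLUB_image_posMinorants_extension hj hR (h0 f f.2)] at hlub
  rwa [Set.image_eq_range]

theorem extension_isRieszHom (hRiesz : IsRieszHom R) : IsRieszHom (extension hj hR) := by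
  refine isRieszHom_of_disjoint fun x y hxy => ?_
  have hx : 0 ≤ x := hxy ▸ inf_le_left
  have hy : 0 ≤ y := hxy ▸ inf_le_right
  refine le_antisymm (inf_le_of_isLUB (isLUB_image_posMinorants_extension hj hR hx)
    (isLUB_image_posMinorants_extension hj hR hy) ?_) (le_inf ?_ ?_)
  · rintro _ ⟨a, ha, rfl⟩ _ ⟨b, hb, rfl⟩
    have hab : a ⊓ b ≤ 0 := by
      rw [← hj.rieszHom.le_iff_le hj.injective, hj.rieszHom.map_inf, map_zero, ← hxy]
      exact inf_le_inf ha.2 hb.2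
    simpa only [hRiesz.map_inf, map_zero] using hR.monotone hab
  · simpa only [map_zero] using extension_monotone hj hR hx
  · simpa only [map_zero] using extension_monotone hj hR hy

end Extension

section Disjointness

theorem inf_eq_zero_of_le {G : Type*} [Lattice G] [Zero G] {a r s : G} (ha : 0 ≤ a) (hr : 0 ≤ r)
    (hrs : r ≤ s) (h : a ⊓ s = 0) : a ⊓ r = 0 :=
  le_antisymm (h ▸ inf_le_inf_left a hrs) (le_inf ha hr)

theorem exists_maximal_disjoint {G : Type*} [Lattice G] [Zero G] (S : Set G) :
    ∃ M ⊆ S, M.Pairwise (fun u v => u ⊓ v = 0) ∧ ∀ v ∈ S, (∀ m ∈ M, m ⊓ v = 0) → v = 0 := by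
  obtain ⟨M, hM⟩ : ∃ M, Maximal (· ∈ {M | M ⊆ S ∧ M.Pairwise (fun u v => u ⊓ v = 0)}) M :=
    zorn_subset _ fun c hc hchain =>
      ⟨⋃₀ c, ⟨Set.sUnion_subset fun s hs => (hc hs).1,
        (Set.pairwise_sUnion hchain.directedOn).2 fun s hs => (hc hs).2⟩,
        fun s hs => Set.subset_sUnion_of_mem hs⟩
  refine ⟨M, hM.prop.1, hM.prop.2, fun v hv hMv => ?_⟩
  have hvM : v ∈ M := hM.le_of_ge ⟨Set.insert_subset hv hM.prop.1,
    hM.prop.2.insert fun m hm _ => ⟨inf_comm m v ▸ hMv m hm, hMv m hm⟩⟩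
    (Set.subset_insert v M) (Set.mem_insert v M)
  simpa only [inf_idem] using hMv v hvM

variable {G : Type*} [AddCommGroup G] [Lattice G] [IsOrderedAddMonoid G]

theorem add_inf_eq_zero {a b r : G} (ha : 0 ≤ a) (hb : 0 ≤ b) (hr : 0 ≤ r)
    (har : a ⊓ r = 0) (hbr : b ⊓ r = 0) : (a + b) ⊓ r = 0 := by
  refine le_antisymm ?_ (le_inf (add_nonneg ha hb) hr)
  have hle : (a + b) ⊓ r - a ≤ b ⊓ r :=
    le_inf (sub_le_iff_le_add'.2 inf_le_left) ((sub_le_self _ ha).trans inf_le_right)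
  rw [hbr, sub_nonpos] at hle
  exact har ▸ le_inf hle inf_le_right

theorem inf_nsmul_eq_zero {a r : G} (ha : 0 ≤ a) (hr : 0 ≤ r) (h : a ⊓ r = 0) (n : ℕ) :
    a ⊓ n • r = 0 := by
  induction n with
  | zero => rw [zero_nsmul, inf_eq_right.2 ha]
  | succ k ih =>
    rw [inf_comm] at h ih ⊢
    rw [succ_nsmul]
    exact add_inf_eq_zero (nsmul_nonneg hr k) hr ha ih h

theorem posPart_sub_pos_iff {a b : G} : 0 < (a - b)⁺ ↔ ¬ a ≤ b := by
  rw [posPart_def, right_lt_sup, sub_nonpos]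

theorem posPart_sub_inf_posPart_sub_eq_zero {b q s : G} (hb : q ⊓ b ≤ s) :
    (b - q)⁺ ⊓ (q - s)⁺ = 0 := by
  refine inf_eq_zero_of_le (posPart_nonneg _) (posPart_nonneg _) ?_
    (posPart_inf_negPart_eq_zero (b - q))
  rw [← posPart_neg, neg_sub, ← sub_le_sub_iff_left q, ← inf_eq_sub_posPart_sub,
    ← inf_eq_sub_posPart_sub]
  exact le_inf inf_le_left hb

end Disjointness

section LateralCompleteness

variable {G : Type*} [AddCommGroup G] [ConditionallyCompleteLattice G] [IsOrderedAddMonoid G]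

theorem nonpos_of_forall_nsmul_le {t w : G} (h : ∀ n : ℕ, n • t ≤ w) : t ≤ 0 := by
  have hlub := isLUB_csSup (Set.range_nonempty fun n : ℕ => n • t) ⟨w, Set.forall_mem_range.2 h⟩
  have hle : sSup (Set.range fun n : ℕ => n • t) ≤ sSup (Set.range fun n : ℕ => n • t) - t :=
    hlub.2 (Set.forall_mem_range.2 fun n =>
      le_sub_iff_add_le.2 (hlub.1 ⟨n + 1, succ_nsmul t n⟩))
  simpa only [le_sub_self_iff] using hle

/-- `v` is the component of `x` in the band generated by `r`, and `w` its component in the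
disjoint complement of `r`. -/
theorem exists_band_decomposition [Module ℝ G] {x r : G} (hr : 0 ≤ r) (hrx : r ≤ x) :
    ∃ v w, v + w = x ∧ r ≤ v ∧ 0 ≤ w ∧ w ⊓ r = 0 ∧ ∀ y, 0 ≤ y → y ⊓ r = 0 → y ⊓ v = 0 := by
  set D : Set G := {y | (0 ≤ y ∧ y ≤ x) ∧ y ⊓ r = 0}
  have h0 : (0 : G) ∈ D := ⟨⟨le_rfl, hr.trans hrx⟩, inf_eq_left.2 hr⟩
  have hw := isLUB_csSup ⟨0, h0⟩ (⟨x, fun y hy => hy.1.2⟩ : BddAbove D)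
  set w := sSup D
  have hw0 : 0 ≤ w := hw.1 h0
  have hwx : w ≤ x := hw.2 fun y hy => hy.1.2
  have hwr : w ⊓ r = 0 := by
    refine le_antisymm ?_ (le_inf hw0 hr)
    rw [inf_comm]
    exact (isLUB_inf hw r).2 (Set.forall_mem_image.2 fun y hy => (inf_comm r y ▸ hy.2).le)
  refine ⟨x - w, w, sub_add_cancel x w, ?_, hw0, hwr, fun y hy hyr => ?_⟩
  · rw [le_sub_iff_add_le', ← inf_add_sup w r, hwr, zero_add]
    exact sup_le hwx hrx
  · set t := y ⊓ (x - w)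
    have ht0 : 0 ≤ t := le_inf hy (sub_nonneg.2 hwx)
    have htr : t ⊓ r = 0 := by
      rw [inf_comm] at hyr ⊢
      exact inf_eq_zero_of_le hr ht0 inf_le_left hyr
    have hwt : w + t ∈ D := ⟨⟨add_nonneg hw0 ht0, le_sub_iff_add_le'.1 inf_le_right⟩,
      add_inf_eq_zero hw0 ht0 hr hwr htr⟩
    exact le_antisymm (by simpa only [add_le_iff_nonpos_right] using hw.1 hwt) ht0

/-- On the band generated by `(q - s)⁺` the component `v` of `q` dominates all of `B`. -/
theorem exists_pos_forall_posPart_sub_inf_eq_zero [Module ℝ G] {B : Set G} (hne : B.Nonempty)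
    (h0 : ∀ b ∈ B, 0 ≤ b) {q : G} (hq : 0 ≤ q) (hB : ¬ IsLUB ((fun b => q ⊓ b) '' B) q) :
    ∃ v, 0 < v ∧ (∀ b ∈ B, (b - v)⁺ ⊓ v = 0) ∧ ∀ y, 0 ≤ y → y ⊓ q = 0 → y ⊓ v = 0 := by
  obtain ⟨s, hs, hqs⟩ : ∃ s ∈ upperBounds ((fun b => q ⊓ b) '' B), ¬ q ≤ s := by
    by_contra! h
    exact hB ⟨Set.forall_mem_image.2 fun b _ => inf_le_left, h⟩
  have hs0 : 0 ≤ s := let ⟨b, hb⟩ := hne; (le_inf hq (h0 b hb)).trans (hs ⟨b, hb, rfl⟩)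
  have hr : 0 < (q - s)⁺ := posPart_sub_pos_iff.2 hqs
  have hrq : (q - s)⁺ ≤ q := sup_le (sub_le_self q hs0) hq
  obtain ⟨v, w, hvw, hrv, hw0, hwr, hv⟩ := exists_band_decomposition hr.le hrq
  refine ⟨v, hr.trans_le hrv, fun b hb => hv _ (posPart_nonneg _) ?_,
    fun y hy hyq => hv y hy (inf_eq_zero_of_le hy hr.le hrq hyq)⟩
  have hle : (b - v)⁺ ≤ (b - q)⁺ + w := by
    refine sup_le ?_ (add_nonneg (posPart_nonneg _) hw0)
    rw [← sub_add_cancel (b - v) w, sub_sub, hvw]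
    exact add_le_add_left (le_posPart _) w
  have hdisj := add_inf_eq_zero (posPart_nonneg _) hw0 hr.le
    (posPart_sub_inf_posPart_sub_eq_zero (hs ⟨b, hb, rfl⟩)) hwr
  rw [inf_comm] at hdisj ⊢
  exact inf_eq_zero_of_le hr.le (posPart_nonneg _) hle hdisj

/-- Lateral completeness: pairwise disjoint positive elements have a supremum. -/
def IsLaterallyComplete (G : Type*) [Lattice G] [Zero G] : Prop :=
  ∀ A : Set G, A.Nonempty → (∀ u ∈ A, 0 ≤ u) → A.Pairwise (fun u v => u ⊓ v = 0) → ∃ w, IsLUB A w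

/-- The bound is the supremum of a maximal disjoint family of elements `m` that dominate `B` on
their own band. -/
theorem IsLaterallyComplete.bddAbove_of_forall_not_isLUB [Module ℝ G] (hG : IsLaterallyComplete G)
    {B : Set G} (hne : B.Nonempty) (h0 : ∀ b ∈ B, 0 ≤ b)
    (hB : ∀ q, 0 < q → ∃ n : ℕ, ¬ IsLUB ((fun b => n • q ⊓ b) '' B) (n • q)) : BddAbove B := by
  obtain ⟨M, hMS, hM, hmax⟩ := exists_maximal_disjoint
    {v : G | 0 ≤ v ∧ ∀ b ∈ B, (b - v)⁺ ⊓ v = 0}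
  obtain ⟨u, hu⟩ := hG (insert 0 M) (Set.insert_nonempty 0 M)
    (Set.forall_mem_insert.2 ⟨le_rfl, fun m hm => (hMS hm).1⟩)
    (hM.insert fun m hm _ => ⟨inf_eq_left.2 (hMS hm).1, inf_eq_right.2 (hMS hm).1⟩)
  refine ⟨u, fun b hb => ?_⟩
  by_contra hbu
  have hq : 0 < (b - u)⁺ := posPart_sub_pos_iff.2 hbu
  have hMq : ∀ m ∈ M, m ⊓ (b - u)⁺ = 0 := fun m hm =>
    inf_eq_zero_of_le (hMS hm).1 hq.le
      (posPart_mono (sub_le_sub_left (hu.1 (Set.mem_insert_of_mem 0 hm)) b))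
      (inf_comm m _ ▸ (hMS hm).2 b hb)
  obtain ⟨n, hn⟩ := hB _ hq
  obtain ⟨v, hv0, hvB, hv⟩ :=
    exists_pos_forall_posPart_sub_inf_eq_zero hne h0 (nsmul_nonneg hq.le n) hn
  exact hv0.ne' (hmax v ⟨hv0.le, hvB⟩ fun m hm =>
    hv m (hMS hm).1 (inf_nsmul_eq_zero (hMS hm).1 hq.le (hMq m hm) n))

end LateralCompleteness

section ConditionalExpectation

variable {E U : Type*} [AddCommGroup E] [ConditionallyCompleteLattice E]
  [IsOrderedAddMonoid E] [Module ℝ E] [IsOrderedModule ℝ E]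
  [AddCommGroup U] [ConditionallyCompleteLattice U] [IsOrderedAddMonoid U]
  [Module ℝ U] [IsOrderedModule ℝ U]
  {C : ConditionalRieszTriple E} {K : UniversalCompletion E U}

theorem ι_isOrderContinuous : IsOrderContinuous K.ι :=
  isOrderContinuous_of_isLUB_image K.ι_rieszHom.monotone fun _ _ _ _ _ h => isLUB_ι h

/-- If `B` were unbounded in the direction `q`, then `n • q` would be the supremum of the
`n • q ⊓ b` for every `n`, and order continuity would bound all multiples of a nonzero `T p`. -/
theorem exists_not_isLUB_inf_nsmul {B : Set E} (hne : B.Nonempty) (hd : DirectedOn (· ≤ ·) B)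
    (hB : BddAbove ((fun b => K.ι (C.T b)) '' B)) {q : U} (hq : 0 < q) :
    ∃ n : ℕ, ¬ IsLUB ((fun b => n • q ⊓ b) '' (K.ι '' B)) (n • q) := by
  by_contra! hlub
  obtain ⟨w, hw⟩ := hB
  obtain ⟨p, hp, hpq⟩ := K.orderDense q hq
  have hle : ∀ n : ℕ, n • K.ι (C.T p) ≤ w := fun n => by
    have hnpq : K.ι (n • p) ≤ n • q := map_nsmul K.ι n p ▸ nsmul_le_nsmul_right hpq n
    have hnp : IsLUB (K.ι '' ((fun b => n • p ⊓ b) '' B)) (K.ι (n • p)) := by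
      simpa only [Set.image_image, ← inf_assoc, inf_eq_left.2 hnpq, K.ι_rieszHom.map_inf]
        using isLUB_inf (hlub n) (K.ι (n • p))
    rw [← map_nsmul, ← map_nsmul]
    refine ι_T_le (hne.image _) (hd.mono_comp fun _ _ h => inf_le_inf_left _ h) hnp ?_ le_rfl
    refine Set.forall_mem_image.2 (Set.forall_mem_image.2 fun b hb => ?_)
    exact (ι_le_iff.2 (T_mono inf_le_right)).trans (hw ⟨b, hb, rfl⟩)
  have hTp : C.T p ≤ 0 := by
    rw [← ι_le_iff (K := K), map_zero]
    exact nonpos_of_forall_nsmul_le hle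
  exact hp.ne' (C.T_strict p hp.le (hTp.antisymm (C.T_nonneg p hp.le)))

theorem bddAbove_ι_of_bddAbove_T {B : Set E} (hne : B.Nonempty) (hd : DirectedOn (· ≤ ·) B)
    (h0 : ∀ b ∈ B, 0 ≤ b) (hB : BddAbove ((fun b => K.ι (C.T b)) '' B)) :
    BddAbove (K.ι '' B) :=
  IsLaterallyComplete.bddAbove_of_forall_not_isLUB K.laterallyComplete (hne.image K.ι)
    (Set.forall_mem_image.2 fun b hb => ι_nonneg (h0 b hb))
    fun _ hq => exists_not_isLUB_inf_nsmul hne hd hB hq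

instance : IsOrderedAddMonoid (L1 C K) where
  add_le_add_left _ _ h c := add_le_add_left (α := U) h c

instance : IsOrderedModule ℝ (L1 C K) where
  smul_le_smul_of_nonneg_left _ hc _ _ h := smul_le_smul_of_nonneg_left (β := U) h hc
  smul_le_smul_of_nonneg_right _ hf _ _ h := smul_le_smul_of_nonneg_right (β := U) h hf

theorem L1_subtype_isRieszHom : IsRieszHom (L1 C K).subtype := fun _ _ => rfl

theorem mem_L1Cone_of_nonneg {f : L1 C K} (hf : 0 ≤ f) : (f : U) ∈ L1Cone C K := by
  rw [← sup_eq_left.2 (show (0 : U) ≤ f from hf)]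
  exact L1Cone_sup_zero f.2

theorem toL1_isOrderDenseEmbedding : IsOrderDenseEmbedding (toL1 C K) where
  rieszHom x y := Subtype.ext (K.ι_rieszHom x y)
  injective _ _ h := K.ι_injective (congrArg Subtype.val h)
  isLUB_posMinorants x hx := by
    refine IsLUB.of_image (f := Subtype.val) Iff.rfl ?_
    rw [Set.image_image]
    exact isLUB_minorants hx

theorem isOrderContinuous_of_T_comp_eq {S : E →ₗ[ℝ] E} (hS : ∀ x, 0 ≤ x → 0 ≤ S x)
    (hTS : ∀ x, C.T (S x) = C.T x) :
    IsOrderContinuous S := by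
  intro A hne hd hA
  refine ⟨Set.forall_mem_image.2 fun a ha => hS a (hA.1 ha), fun y hy => ?_⟩
  have hT : C.T (y ⊔ 0) ≤ 0 := by
    refine (C.T_orderContinuous A hne hd hA).2 (Set.forall_mem_image.2 fun a ha => ?_)
    rw [← hTS a]
    exact T_mono (sup_le (hy ⟨a, ha, rfl⟩) (hS a (hA.1 ha)))
  exact sup_eq_right.1 (C.T_strict _ le_sup_right (hT.antisymm (C.T_nonneg _ le_sup_right)))

theorem isOrderExtendable_ι_comp {S : E →ₗ[ℝ] E} (hS : ∀ x, 0 ≤ x → 0 ≤ S x)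
    (hTS : ∀ x, C.T (S x) = C.T x) :
    IsOrderExtendable (toL1 C K) (K.ι ∘ₗ S) where
  monotone := K.ι_rieszHom.monotone.comp ((monotone_iff_map_nonneg S).2 hS)
  orderContinuous := ι_isOrderContinuous.comp (isOrderContinuous_of_T_comp_eq hS hTS)
    ((monotone_iff_map_nonneg S).2 hS)
  bddAbove_image_posMinorants x hx := by
    have hbdd : BddAbove ((fun z => K.ι (C.T z)) '' (S '' minorants K (x : U))) := by
      simpa only [Set.image_image, hTS] using bddAbove_minorants (mem_L1Cone_of_nonneg hx)
    rw [LinearMap.coe_comp, Set.image_comp]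
    exact bddAbove_ι_of_bddAbove_T ((posMinorants_nonempty hx).image S)
      ((directed_minorants _).mono_comp fun _ _ h => (monotone_iff_map_nonneg S).2 hS h)
      (Set.forall_mem_image.2 fun z hz => hS z hz.1) hbdd

variable {S : E →ₗ[ℝ] E} (hS : ∀ x, 0 ≤ x → 0 ≤ S x) (hTS : ∀ x, C.T (S x) = C.T x)

theorem extension_mem_L1 (f : L1 C K) :
    extension toL1_isOrderDenseEmbedding (isOrderExtendable_ι_comp hS hTS) f ∈ L1 C K := by
  have hmono : Monotone S := (monotone_iff_map_nonneg S).2 hS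
  have hpos : ∀ x : L1 C K, 0 ≤ x →
      extension toL1_isOrderDenseEmbedding (isOrderExtendable_ι_comp hS hTS) x ∈ L1 C K := by
    intro x hx
    refine L1_of_cone ⟨S '' minorants K x, (posMinorants_nonempty (j := toL1 C K) hx).image S,
      (directed_minorants _).mono_comp fun _ _ h => hmono h,
      Set.forall_mem_image.2 fun z hz => hS z hz.1, ?_, ?_⟩
    · rw [← Set.image_comp]
      exact isLUB_image_posMinorants_extension toL1_isOrderDenseEmbedding
        (isOrderExtendable_ι_comp hS hTS) hx
    · simpa only [Set.image_image, hTS] using bddAbove_minorants (mem_L1Cone_of_nonneg hx)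
  rw [← posPart_sub_negPart f, map_sub]
  exact (L1 C K).sub_mem (hpos _ (posPart_nonneg f)) (hpos _ (negPart_nonneg f))

/-- The extension to `L¹(T)` of a positive operator `S` on `E` with `T S = T`. -/
noncomputable def L1Extension : L1 C K →ₗ[ℝ] L1 C K :=
  (extension toL1_isOrderDenseEmbedding (isOrderExtendable_ι_comp hS hTS)).codRestrict (L1 C K)
    (extension_mem_L1 hS hTS)

theorem L1Extension_toL1 (x : E) : L1Extension hS hTS (toL1 C K x) = toL1 C K (S x) :=
  Subtype.ext (LinearMap.congr_fun
    (extension_comp_self toL1_isOrderDenseEmbedding (isOrderExtendable_ι_comp hS hTS)) x)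

theorem L1Extension_monotone : Monotone (L1Extension (K := K) hS hTS) := fun _ _ h =>
  extension_monotone toL1_isOrderDenseEmbedding (isOrderExtendable_ι_comp hS hTS) h

theorem L1Extension_isOrderContinuous : IsOrderContinuous (L1Extension (K := K) hS hTS) :=
  .of_comp L1_subtype_isRieszHom (L1 C K).injective_subtype
    (extension_isOrderContinuous toL1_isOrderDenseEmbedding (isOrderExtendable_ι_comp hS hTS))

theorem L1Extension_isRieszHom (hRiesz : IsRieszHom S) :
    IsRieszHom (L1Extension (K := K) hS hTS) :=
  .of_comp L1_subtype_isRieszHom (L1 C K).injective_subtype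
    (extension_isRieszHom toL1_isOrderDenseEmbedding (isOrderExtendable_ι_comp hS hTS)
      (K.ι_rieszHom.comp hRiesz))

theorem condExp_eq_L1Extension : condExp C K = L1Extension C.T_nonneg C.T_proj := rfl

theorem condExp_L1Extension (f : L1 C K) : condExp C K (L1Extension hS hTS f) = condExp C K f := by
  have hext : L1Extension C.T_nonneg C.T_proj ∘ₗ L1Extension (K := K) hS hTS =
      L1Extension C.T_nonneg C.T_proj :=
    toL1_isOrderDenseEmbedding.linearMap_ext
      ((L1Extension_isOrderContinuous C.T_nonneg C.T_proj).comp
        (L1Extension_isOrderContinuous hS hTS) (L1Extension_monotone hS hTS))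
      (L1Extension_isOrderContinuous C.T_nonneg C.T_proj) fun z => by
        rw [LinearMap.comp_apply, L1Extension_toL1, L1Extension_toL1, L1Extension_toL1, hTS]
  rw [condExp_eq_L1Extension]
  exact LinearMap.congr_fun hext f

end ConditionalExpectation

end CondExp

open CondExp in
theorem mainTheorem4_general {E U : Type*}
    [AddCommGroup E] [ConditionallyCompleteLattice E] [IsOrderedAddMonoid E]
    [Module ℝ E] [IsOrderedModule ℝ E]
    [AddCommGroup U] [ConditionallyCompleteLattice U] [IsOrderedAddMonoid U]
    [Module ℝ U] [IsOrderedModule ℝ U]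
    (C : ConditionalRieszTriple E) (K : UniversalCompletion E U) {S : E →ₗ[ℝ] E}
    (hS : ∀ x, 0 ≤ x → 0 ≤ S x) (hTS : ∀ x, C.T (S x) = C.T x) :
    ∃ S' : L1 C K →ₗ[ℝ] L1 C K,
      (Monotone S' ∧ (IsRieszHom S → IsRieszHom S') ∧ IsOrderContinuous S' ∧
        ∀ x, S' (toL1 C K x) = toL1 C K (S x)) ∧
      (∀ f, condExp C K (S' f) = condExp C K f) ∧
      ∀ S'' : L1 C K →ₗ[ℝ] L1 C K, IsOrderContinuous S'' →
        (∀ x, S'' (toL1 C K x) = toL1 C K (S x)) → S'' = S' :=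
  ⟨L1Extension hS hTS,
    ⟨L1Extension_monotone hS hTS, L1Extension_isRieszHom hS hTS,
      L1Extension_isOrderContinuous hS hTS, L1Extension_toL1 hS hTS⟩,
    condExp_L1Extension hS hTS,
    fun _ hcont hext => toL1_isOrderDenseEmbedding.linearMap_ext hcont
      (L1Extension_isOrderContinuous hS hTS)
      fun x => (hext x).trans (L1Extension_toL1 hS hTS x).symm⟩

theorem mainTheorem4 {E U : Type*}
    [AddCommGroup E] [ConditionallyCompleteLattice E] [IsOrderedAddMonoid E]
    [Module ℝ E] [IsOrderedModule ℝ E]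
    [AddCommGroup U] [ConditionallyCompleteLattice U] [IsOrderedAddMonoid U]
    [Module ℝ U] [IsOrderedModule ℝ U]
    (P : CondExpPreservingSystem E) (K : UniversalCompletion E U) :
    ∃ S : CondExp.L1 P.toConditionalRieszTriple K →ₗ[ℝ] CondExp.L1 P.toConditionalRieszTriple K,
      (IsRieszHom S ∧ IsOrderContinuous S ∧
        ∀ x : E, S (CondExp.toL1 P.toConditionalRieszTriple K x) =
          CondExp.toL1 P.toConditionalRieszTriple K (P.S x)) ∧
      (∀ f, CondExp.condExp P.toConditionalRieszTriple K (S f) =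
        CondExp.condExp P.toConditionalRieszTriple K f) ∧
      ∀ S' : CondExp.L1 P.toConditionalRieszTriple K →ₗ[ℝ]
          CondExp.L1 P.toConditionalRieszTriple K,
        IsRieszHom S' → IsOrderContinuous S' →
        (∀ x : E, S' (CondExp.toL1 P.toConditionalRieszTriple K x) =
          CondExp.toL1 P.toConditionalRieszTriple K (P.S x)) →
        S' = S := by
  obtain ⟨S', ⟨-, hRiesz, hcont, hext⟩, hcond, huniq⟩ :=
    mainTheorem4_general P.toConditionalRieszTriple K
      ((monotone_iff_map_nonneg P.S).1 P.S_rieszHom.monotone) P.T_S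
  exact ⟨S', ⟨hRiesz P.S_rieszHom, hcont, hext⟩, hcond, fun S'' _ => huniq S''⟩
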